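/- **Theorem.** Let $\Phi$ be a 3SAT formula with variables $x_0,\dots,x_{n-1}$ and clauses $C_0,\dots,C_{m-1}$, $m\ge 1$, each clause being a disjunction of three literals (repetitions allowed), and let $\mathrm{SAT}(\Phi)\subseteq\mathbb R^n$ be the convex hull of the $0/1$ vectors of the satisfying assignments of $\Phi$. For a hypergraph $H$ whose hyperedges are triples of distinct vertices, let $\mathrm{3DM}(H)\subseteq\mathbb R^{E(H)}$ be the convex hull of the characteristic vectors of the sets of pairwise disjoint hyperedges of $H$. Let $H=H(\Phi)$ be the hypergraph of the standard reduction from 3SAT to 3-dimensional matching. Its vertices are $u_i[j],\bar u_i[j],a_i[j],b_i[j]$ ($i<n$, $j<m$), $s_1[j],s_2[j]$ ($j<m$) and $g_1[k],g_2[k]$ ($k<m(n-1)$). Its hyperedges are: * for each variable $x_i$, a gadget of $2m$ hyperedges: the light ones $\{\bar u_i[j],a_i[j],b_i[j]\}$ and the dark ones $\{u_i[j],a_i[j+1 \bmod m],b_i[j]\}$, $j<m$; * for each clause $C_j$, a gadget with the hyperedges $\{u_i[j],s_1[j],s_2[j]\}$ for the literals $x_i$ of $C_j$ and $\{\bar u_i[j],s_1[j],s_2[j]\}$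 for the literals $\bar x_i$ of $C_j$; * the garbage collection hyperedges $\{u_i[j],g_1[k],g_2[k]\}$ and $\{\bar u_i[j],g_1[k],g_2[k]\}$ for all $i,j,k$. Let $F$ be the set of all $y\in\mathrm{3DM}(H)$ on which every variable gadget and every clause gadget is perfectly matched, that is, for every variable the $2m$ coordinates of its gadget sum to $m$, and for every clause the coordinates of its gadget sum to $1$. Then $F$ is a face of $\mathrm{3DM}(H)$, and $\mathrm{SAT}(\Phi)$ is a projection of $F$: for every choice of one light hyperedge $e_i$ in the gadget of each variable $x_i$, the coordinate projection $y\mapsto(y_{e_0},\dots,y_{e_{n-1}})$ maps $F$ onto $\mathrm{SAT}(\Phi)$. **Corollary.** For a polytope $P$, let $\mathrm{xc}(P)$ be the minimum number of facets of a polytope of which $P$ is the image under a linear map. There are constants $C$ and $c>0$ such that for every integer $n\ge 1$ there is a hypergraph $H$ of triples with at most $Cn$ vertices and $\mathrm{xc}(\mathrm{3DM}(H))\ge 2^{c\,n^{1/4}}$. -/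

import Mathlib

namespace ThreeDM

/-! ### 3SAT formulas and their polytopes -/

/-- A literal over the variables `x_0, …, x_{n-1}`: `(i, true)` is `x_i`, `(i, false)` is its
negation. -/
abbrev Literal (n : ℕ) : Type := Fin n × Bool

/-- A 3CNF formula with `n` variables and `m` clauses: a list of `m` clauses, each of them a
disjunction of three literals (which may coincide). -/
abbrev Formula (n m : ℕ) : Type := Fin m → Fin 3 → Literal n

/-- The assignment `σ` satisfies the formula `Φ`: every clause has a true literal. -/
def Satisfies {n m : ℕ} (Φ : Formula n m) (σ : Fin n → Bool) : Prop :=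
  ∀ j : Fin m, ∃ p : Fin 3, σ (Φ j p).1 = (Φ j p).2

/-- The polytope `SAT(Φ) ⊆ ℝⁿ`, the convex hull of the 0/1 vectors of satisfying assignments. -/
def SATPolytope {n m : ℕ} (Φ : Formula n m) : Set (Fin n → ℝ) :=
  convexHull ℝ {x | ∃ σ : Fin n → Bool, Satisfies Φ σ ∧ x = fun i => if σ i = true then 1 else 0}

/-! ### Hypergraphs of triples and the 3d-matching polytope -/

/-- A hypergraph on the vertex set `V` whose hyperedges are triples of distinct vertices. -/
structure TripleHypergraph (V : Type*) where
  edges : Finset (Finset V)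
  card_edge : ∀ e ∈ edges, e.card = 3

/-- A 3-dimensional matching: a set of pairwise disjoint hyperedges. -/
def TripleHypergraph.IsMatching {V : Type*} (H : TripleHypergraph V)
    (M : Finset (Finset V)) : Prop :=
  M ⊆ H.edges ∧ ∀ e ∈ M, ∀ f ∈ M, e ≠ f → Disjoint e f

open Classical in
/-- The polytope `3DM(H) ⊆ ℝ^E`, the convex hull of the characteristic vectors of matchings. -/
noncomputable def TripleHypergraph.matchingPolytope {V : Type*} (H : TripleHypergraph V) :
    Set ({e // e ∈ H.edges} → ℝ) :=
  convexHull ℝ {y | ∃ M : Finset (Finset V), H.IsMatching M ∧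
    y = fun e => if e.1 ∈ M then 1 else 0}

/-! ### Extension complexity -/

/-- A polytope: the convex hull of finitely many points. -/
def IsPolytope {ι : Type*} (P : Set (ι → ℝ)) : Prop :=
  ∃ s : Set (ι → ℝ), s.Finite ∧ P = convexHull ℝ s

/-- The facets of `Q`: the nonempty faces of dimension `dim Q - 1`. -/
def facets {ι : Type*} (Q : Set (ι → ℝ)) : Set (Set (ι → ℝ)) :=
  {F | IsExposed ℝ Q F ∧ F.Nonempty ∧
    Module.finrank ℝ (vectorSpan ℝ F) + 1 = Module.finrank ℝ (vectorSpan ℝ Q)}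

/-- `P` has an extension with exactly `k` facets: some polytope `Q ⊆ ℝ^d` with `k` facets has `P`
as its image under a linear map. -/
def HasExtension {ι : Type*} (P : Set (ι → ℝ)) (k : ℕ) : Prop :=
  ∃ (d : ℕ) (Q : Set (Fin d → ℝ)) (π : (Fin d → ℝ) →ₗ[ℝ] (ι → ℝ)),
    IsPolytope Q ∧ π '' Q = P ∧ (facets Q).encard = (k : ℕ∞)

/-- The extension complexity of a polytope `P`: the minimum number of facets of an extension. -/
noncomputable def extensionComplexity {ι : Type*} (P : Set (ι → ℝ)) : ℕ :=
  sInf {k | HasExtension P k}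

/-- A polytope has finitely many facets. -/
theorem IsPolytope.finite_facets {ι : Type*} [Fintype ι] {Q : Set (ι → ℝ)} (hQ : IsPolytope Q) :
    (facets Q).Finite := by
  obtain ⟨s, hs, rfl⟩ := hQ
  have hc : IsCompact (convexHull ℝ s) := hs.isCompact_convexHull (𝕜 := ℝ)
  refine Set.Finite.of_finite_image (f := fun F => F.extremePoints ℝ)
    (hs.finite_subsets.subset ?_) ?_
  · rintro _ ⟨F, hF, rfl⟩
    exact (hF.1.isExtreme.extremePoints_subset_extremePoints).trans
      extremePoints_convexHull_subset
  · intro F hF G hG h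
    have h1 := closure_convexHull_extremePoints (hF.1.isCompact hc)
      (hF.1.convex (convex_convexHull ℝ s))
    have h2 := closure_convexHull_extremePoints (hG.1.isCompact hc)
      (hG.1.convex (convex_convexHull ℝ s))
    have h3 : F.extremePoints ℝ = G.extremePoints ℝ := h
    rw [← h1, ← h2, h3]

/-- Every polytope has an extension, so the minimum defining the extension complexity is over a
nonempty set. -/
theorem IsPolytope.exists_hasExtension {ι : Type*} [Fintype ι] {P : Set (ι → ℝ)}
    (hP : IsPolytope P) : ∃ k, HasExtension P k := by
  obtain ⟨s, hs, rfl⟩ := hP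
  let φ : (Fin (Fintype.card ι) → ℝ) ≃ₗ[ℝ] (ι → ℝ) :=
    LinearEquiv.funCongrLeft ℝ ℝ (Fintype.equivFin ι)
  have hQ : IsPolytope (convexHull ℝ (φ.symm '' s)) := ⟨_, hs.image _, rfl⟩
  obtain ⟨k, hk⟩ := ENat.ne_top_iff_exists.mp (Set.encard_ne_top_iff.mpr hQ.finite_facets)
  refine ⟨k, _, _, φ.toLinearMap, hQ, ?_, hk.symm⟩
  rw [LinearMap.image_convexHull, Set.image_image]
  simp

/-! ### The standard reduction from 3SAT to 3d-matching -/

/-- The vertices of the hypergraph of the reduction, for `n` variables and `m` clauses. The vertex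
`tip i b j` belongs to the literal `(i, b)` and the clause `j`. -/
inductive RVertex (n m : ℕ) : Type
  | tip (i : Fin n) (b : Bool) (j : Fin m)
  | coreA (i : Fin n) (j : Fin m)
  | coreB (i : Fin n) (j : Fin m)
  | clauseA (j : Fin m)
  | clauseB (j : Fin m)
  | garbageA (k : Fin (m * (n - 1)))
  | garbageB (k : Fin (m * (n - 1)))
  deriving DecidableEq, Fintype

open RVertex

/-- The light hyperedges of the gadget of the variable `x_i`; selecting them means that `x_i` is
true, and leaves the tips of the literal `x_i` uncovered. -/
def lightTriple {n m : ℕ} (i : Fin n) (j : Fin m) : Finset (RVertex n m) :=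
  {tip i false j, coreA i j, coreB i j}

/-- The dark hyperedges of the gadget of the variable `x_i`; selecting them means that `x_i` is
false. Here `finRotate m j` is `j + 1` modulo `m`. -/
def darkTriple {n m : ℕ} (i : Fin n) (j : Fin m) : Finset (RVertex n m) :=
  {tip i true j, coreA i (finRotate m j), coreB i j}

/-- The hyperedge of the gadget of the clause `j` for the literal `l`. -/
def clauseTriple {n m : ℕ} (l : Literal n) (j : Fin m) : Finset (RVertex n m) :=
  {tip l.1 l.2 j, clauseA j, clauseB j}

/-- The hyperedges of the garbage collection gadget. -/
def garbageTriple {n m : ℕ} (l : Literal n) (j : Fin m) (k : Fin (m * (n - 1))) :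
    Finset (RVertex n m) :=
  {tip l.1 l.2 j, garbageA k, garbageB k}

/-- The hypergraph of the standard reduction from 3SAT to 3d-matching. -/
def reduction {n m : ℕ} (Φ : Formula n m) : TripleHypergraph (RVertex n m) where
  edges :=
    (Finset.univ.image fun q : Fin n × Fin m => lightTriple q.1 q.2) ∪
    (Finset.univ.image fun q : Fin n × Fin m => darkTriple q.1 q.2) ∪
    (Finset.univ.image fun q : Fin m × Fin 3 => clauseTriple (Φ q.1 q.2) q.1) ∪
    (Finset.univ.image fun q : Literal n × Fin m × Fin (m * (n - 1)) =>
      garbageTriple q.1 q.2.1 q.2.2)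
  card_edge := by
    intro e he
    simp only [Finset.mem_union, Finset.mem_image, Finset.mem_univ, true_and] at he
    rcases he with ((⟨q, rfl⟩ | ⟨q, rfl⟩) | ⟨q, rfl⟩) | ⟨q, rfl⟩ <;>
      exact Finset.card_eq_three.mpr ⟨_, _, _, by simp, by simp, by simp, rfl⟩

/-- The light hyperedges, as hyperedges of the hypergraph of the reduction. -/
def lightEdge {n m : ℕ} (Φ : Formula n m) (i : Fin n) (j : Fin m) :
    {e // e ∈ (reduction Φ).edges} :=
  ⟨lightTriple i j, by
    simp only [reduction, Finset.mem_union, Finset.mem_image, Finset.mem_univ, true_and]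
    exact Or.inl (Or.inl (Or.inl ⟨(i, j), rfl⟩))⟩

/-- The dark hyperedges, as hyperedges of the hypergraph of the reduction. -/
def darkEdge {n m : ℕ} (Φ : Formula n m) (i : Fin n) (j : Fin m) :
    {e // e ∈ (reduction Φ).edges} :=
  ⟨darkTriple i j, by
    simp only [reduction, Finset.mem_union, Finset.mem_image, Finset.mem_univ, true_and]
    exact Or.inl (Or.inl (Or.inr ⟨(i, j), rfl⟩))⟩

/-- The part of `3DM(H)`, for the hypergraph `H` of the reduction, on which every variable gadget
and every clause gadget is perfectly matched: exactly `m` of the `2m` hyperedges of each variable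
gadget are selected, and exactly one hyperedge of each clause gadget. -/
noncomputable def gadgetFace {n m : ℕ} (Φ : Formula n m) :
    Set ({e // e ∈ (reduction Φ).edges} → ℝ) :=
  {y | y ∈ (reduction Φ).matchingPolytope ∧
    (∀ i : Fin n, ∑ j : Fin m, (y (lightEdge Φ i j) + y (darkEdge Φ i j)) = m) ∧
    (∀ j : Fin m, ∑ e with clauseA j ∈ e.1, y e = 1)}

end ThreeDM

open ThreeDM ThreeDM.RVertex

/-! A matching has at most one of the two hyperedges through each `coreB i j` and at most one
through each `clauseA j`, so every gadget sum has a valid upper bound. Adding these bounds gives a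
single supporting functional, `gadgetSum`, that is tight exactly when every gadget is, and hence the
face. The face is the hull of the tight matchings (`setOf_mem_convexHull_and_eq`). In a tight
variable gadget the cyclically shared `coreA` vertices force all light or all dark hyperedges
(`lightTriple_mem_of_mem`), and the selected clause hyperedges show that the resulting assignment is
satisfying (`satisfies_of_tight`). Conversely a satisfying assignment yields a tight matching, with
no garbage hyperedges (`isMatching_assignmentMatching`).

For the corollary, the satisfying assignments of `correlationFormula r` are the matrices `b bᵀ`, on
which `correlationFunctional a` equals `1 - (1 - |a ∩ b|)²`. So each `a` cuts out a face containing
the point of `b` exactly when `|a ∩ b| = 1`. Pulled back, it is a face of the matching polytope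
(`IsExposed.trans_of_isPolytope`) and then of any extension. There a facet separates each nonempty
face from a point off it (`IsExposed.exists_facet`), so each facet defines a rectangle of pairs `(a,
b)`. Together with one trivial rectangle these cover all disjoint pairs and contain no pair meeting
in one element, so they number at least `(3/2)^r` (`three_pow_le_card_mul`). The hypergraph has
`O(r⁴)` vertices, whence the exponent `1/4`. -/

/-! ### Faces of polytopes and supporting hyperplanes -/

theorem isExposed_setOf_eq {E : Type*} [TopologicalSpace E] [AddCommGroup E] [Module ℝ E]
    {A : Set E} (l : StrongDual ℝ E) (c : ℝ) (h : ∀ y ∈ A, l y ≤ c) :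
    IsExposed ℝ A {x ∈ A | l x = c} := by
  rintro ⟨x₀, hx₀, hc⟩
  refine ⟨l, Set.ext fun x => and_congr_right fun hx => ⟨fun hxc y hy => hxc ▸ h y hy, fun hm => ?_⟩⟩
  exact le_antisymm (h x hx) (hc ▸ hm x₀ hx₀)

theorem IsExposed.exists_eq_setOf_eq {E : Type*} [TopologicalSpace E] [AddCommGroup E]
    [Module ℝ E] {A B : Set E} (h : IsExposed ℝ A B) (hB : B.Nonempty) :
    ∃ (l : StrongDual ℝ E) (c : ℝ), (∀ y ∈ A, l y ≤ c) ∧ B = {x ∈ A | l x = c} := by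
  obtain ⟨l, rfl⟩ := h hB
  obtain ⟨x₀, hx₀, hm⟩ := hB
  refine ⟨l, l x₀, hm, Set.ext fun x => and_congr_right fun hx => ⟨fun h => ?_, fun h y hy => ?_⟩⟩
  · exact le_antisymm (hm x hx) (h x₀ hx₀)
  · exact h ▸ hm y hy

theorem le_of_mem_convexHull {E : Type*} [AddCommGroup E] [Module ℝ E] {s : Set E}
    (l : E →ₗ[ℝ] ℝ) {c : ℝ} (h : ∀ y ∈ s, l y ≤ c) {y : E} (hy : y ∈ convexHull ℝ s) : l y ≤ c :=
  convexHull_min (t := {y | l y ≤ c}) h (convex_halfSpace_le l.isLinear c) hy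

/-- The face of a convex hull cut out by a supporting hyperplane is the convex hull of the
generators on the hyperplane. -/
theorem setOf_mem_convexHull_and_eq {E : Type*} [AddCommGroup E] [Module ℝ E] {s : Set E}
    (l : E →ₗ[ℝ] ℝ) {c : ℝ} (h : ∀ y ∈ s, l y ≤ c) :
    {y ∈ convexHull ℝ s | l y = c} = convexHull ℝ {y ∈ s | l y = c} := by
  refine Set.Subset.antisymm ?_ fun y hy => ⟨convexHull_mono (fun x hx => hx.1) hy, ?_⟩
  -- The strengthened claim describes a convex set: a combination with positive weights lies on the
  -- hyperplane only if both end points do.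
  · suffices H : convexHull ℝ s ⊆ {y | l y ≤ c ∧ (l y = c → y ∈ convexHull ℝ {y ∈ s | l y = c})} from
      fun y hy => (H hy.1).2 hy.2
    refine convexHull_min (fun y hy => ⟨h y hy, fun hc => subset_convexHull ℝ _ ⟨hy, hc⟩⟩) ?_
    rw [convex_iff_forall_pos]
    rintro x ⟨hx, hx'⟩ y ⟨hy, hy'⟩ a b ha hb hab
    have h1 : l (a • x + b • y) = a * l x + b * l y := by simp
    refine ⟨?_, fun hc => ?_⟩
    · rw [h1]
      have e : c = a * c + b * c := by rw [← add_mul, hab, one_mul]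
      rw [e]; gcongr
    · rw [h1] at hc
      have e : a * (c - l x) + b * (c - l y) = 0 := by linear_combination c * hab - hc
      have hx0 : 0 ≤ a * (c - l x) := mul_nonneg ha.le (by linarith)
      have hy0 : 0 ≤ b * (c - l y) := mul_nonneg hb.le (by linarith)
      have hx1 : a * (c - l x) = 0 := by linarith
      have hy1 : b * (c - l y) = 0 := by linarith
      have hx2 := (mul_eq_zero.mp hx1).resolve_left ha.ne'
      have hy2 := (mul_eq_zero.mp hy1).resolve_left hb.ne'
      exact convex_convexHull ℝ _ (hx' (by linarith)) (hy' (by linarith)) ha.le hb.le hab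
  · exact convexHull_min (t := {y | l y = c}) (fun x hx => hx.2) (convex_hyperplane l.isLinear c) hy

/-- An exposed face of an exposed face of a polytope is an exposed face of the polytope. -/
theorem IsExposed.trans_of_isPolytope {ι : Type*} {P F G : Set (ι → ℝ)} (hP : IsPolytope P)
    (hF : IsExposed ℝ P F) (hG : IsExposed ℝ F G) : IsExposed ℝ P G := by
  rcases G.eq_empty_or_nonempty with rfl | hne
  · exact fun h => absurd h Set.not_nonempty_empty
  obtain ⟨φ, γ, hφ, rfl⟩ := hG.exists_eq_setOf_eq hne
  obtain ⟨l, c, hl, rfl⟩ := hF.exists_eq_setOf_eq (hne.mono fun _ hx => hx.1)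
  obtain ⟨s, hs, rfl⟩ := hP
  -- `M` is a weight on `l` large enough to absorb the excess of `φ` at every generator off the face
  -- `l = c`. Generators on that face are handled by `hφ`, so the junk value of the quotient there
  -- does no harm.
  obtain ⟨M, hM⟩ := (hs.image fun x => (φ x - γ) / (c - l x)).bddAbove
  have key : ∀ y ∈ convexHull ℝ s, (M • l + φ) y ≤ M * c + γ := by
    intro y hy
    refine le_of_mem_convexHull (M • l + φ).toLinearMap (fun x hx => ?_) hy
    have hxs := subset_convexHull ℝ s hx
    have h0 := hl x hxs
    simp only [ContinuousLinearMap.coe_coe, add_apply,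
      smul_apply, smul_eq_mul]
    rcases h0.eq_or_lt with h0 | h0
    · have := hφ x ⟨hxs, h0⟩
      rw [h0]; linarith
    · have := hM ⟨x, hx, rfl⟩
      simp only [div_le_iff₀ (sub_pos.mpr h0)] at this
      linarith
  -- One more copy of `l ≤ c` makes the inequality strict off the face `l = c`, so equality forces
  -- both equations.
  have hstrict : ∀ y ∈ convexHull ℝ s, ((M + 1) • l + φ) y ≤ (M + 1) * c + γ ∧
      (((M + 1) • l + φ) y = (M + 1) * c + γ ↔ l y = c ∧ φ y = γ) := by
    intro y hy
    have h1 := key y hy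
    have h2 := hl y hy
    simp only [add_apply, smul_apply, smul_eq_mul] at h1 ⊢
    refine ⟨by linarith, fun h => ?_, fun h => by rw [h.1, h.2]⟩
    have h3 : l y = c := by linarith
    exact ⟨h3, by rw [h3] at h; linarith⟩
  have hE := isExposed_setOf_eq ((M + 1) • l + φ) ((M + 1) * c + γ) (fun y hy => (hstrict y hy).1)
  refine (congrArg (IsExposed ℝ _) (Set.ext fun y => ?_)).mpr hE
  constructor
  · rintro ⟨⟨hy, h1⟩, h2⟩
    exact ⟨hy, (hstrict y hy).2.2 ⟨h1, h2⟩⟩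
  · rintro ⟨hy, h⟩
    have := (hstrict y hy).2.1 h
    exact ⟨⟨hy, this.1⟩, this.2⟩

/-- A supporting hyperplane of a polytope whose face has codimension at least two can be tilted
about the face until it touches a further vertex, keeping a given point off the face. -/
theorem IsExposed.exists_larger_face {ι : Type*} [Fintype ι] {Q F : Set (ι → ℝ)} {q : ι → ℝ}
    (hQ : IsPolytope Q) (hF : IsExposed ℝ Q F) (hne : F.Nonempty) (hq : q ∈ Q) (hqF : q ∉ F)
    (hdim : Module.finrank ℝ (vectorSpan ℝ F) + 1 ≠ Module.finrank ℝ (vectorSpan ℝ Q)) :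
    ∃ F', IsExposed ℝ Q F' ∧ F ⊆ F' ∧ q ∉ F' ∧
      Module.finrank ℝ (vectorSpan ℝ F) < Module.finrank ℝ (vectorSpan ℝ F') := by
  obtain ⟨l, c, hl, hFl⟩ := hF.exists_eq_setOf_eq hne
  obtain ⟨f₀, hf₀⟩ := hne
  have hf₀' : f₀ ∈ Q ∧ l f₀ = c := by rw [hFl] at hf₀; exact hf₀
  have hlq : l q < c := (hl q hq).lt_of_ne fun h => hqF (by rw [hFl]; exact ⟨hq, h⟩)
  have hle : vectorSpan ℝ F ≤ vectorSpan ℝ Q := vectorSpan_mono ℝ (by rw [hFl]; exact fun x hx => hx.1)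
  have hlW : vectorSpan ℝ F ≤ LinearMap.ker l.toLinearMap := by
    rw [vectorSpan_def, Submodule.span_le]
    rintro _ ⟨x, hx, y, hy, rfl⟩
    rw [hFl] at hx hy
    simp [hx.2, hy.2]
  have hvq : q - f₀ ∈ vectorSpan ℝ Q := vsub_mem_vectorSpan ℝ hq hf₀'.1
  -- a direction in the hyperplane that leaves the span of the face
  obtain ⟨v, hvU, hvl, hvW⟩ : ∃ v ∈ vectorSpan ℝ Q, l v = 0 ∧ v ∉ vectorSpan ℝ F := by
    by_contra! hcon
    refine hdim ?_
    have hsup : vectorSpan ℝ Q = vectorSpan ℝ F ⊔ Submodule.span ℝ {q - f₀} := by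
      refine le_antisymm (fun u hu => ?_) (sup_le hle (by simpa using hvq))
      have hne0 : l (q - f₀) ≠ 0 := by rw [map_sub, hf₀'.2]; exact (sub_neg.mpr hlq).ne
      rw [Submodule.mem_sup]
      refine ⟨u - (l u / l (q - f₀)) • (q - f₀), ?_, _,
        Submodule.smul_mem _ (l u / l (q - f₀)) (Submodule.mem_span_singleton_self _), by simp⟩
      refine hcon _ (Submodule.sub_mem _ hu (Submodule.smul_mem _ _ hvq)) ?_
      rw [map_sub, map_smul, smul_eq_mul, div_mul_cancel₀ _ hne0, sub_self]
    have hnW : q - f₀ ∉ vectorSpan ℝ F := fun h => by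
      have := hlW h
      simp only [LinearMap.mem_ker, ContinuousLinearMap.coe_coe, map_sub, hf₀'.2] at this
      linarith
    have h1 := Submodule.finrank_sup_add_finrank_inf_eq (vectorSpan ℝ F) (Submodule.span ℝ {q - f₀})
    have hdisj : vectorSpan ℝ F ⊓ Submodule.span ℝ {q - f₀} = ⊥ :=
      (Submodule.disjoint_span_singleton_of_notMem hnW).eq_bot
    have hne0 : q - f₀ ≠ 0 := fun h => hnW (by rw [h]; exact Submodule.zero_mem _)
    rw [hdisj, finrank_bot, finrank_span_singleton hne0, ← hsup] at h1
    exact h1.symm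
  obtain ⟨h, hhv, hhW⟩ := Submodule.exists_le_ker_of_notMem hvW
  -- a functional that vanishes on the face and at `q`, but not on `Q`
  obtain ⟨g, hgF, hgq, hgv⟩ : ∃ g : (ι → ℝ) →ₗ[ℝ] ℝ, (∀ x ∈ F, g x = g f₀) ∧ g q = g f₀ ∧ g v ≠ 0 := by
    -- The multiple of `l` is chosen to cancel the value at `q - f₀`; since `l` vanishes on the
    -- directions of `F` and at `v`, nothing else changes.
    refine ⟨h - (h (q - f₀) / l (q - f₀)) • l.toLinearMap, fun x hx => ?_, ?_, by simpa [hvl] using hhv⟩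
    · have hm := vsub_mem_vectorSpan ℝ hx hf₀
      have h1 : h (x - f₀) = 0 := hhW hm
      have h2 : l (x - f₀) = 0 := hlW hm
      rw [← sub_eq_zero, ← map_sub]
      simp only [LinearMap.sub_apply, LinearMap.smul_apply, ContinuousLinearMap.coe_coe, h1, h2]
      simp
    · have hne0 : l (q - f₀) ≠ 0 := by rw [map_sub, hf₀'.2]; exact (sub_neg.mpr hlq).ne
      rw [← sub_eq_zero, ← map_sub]
      simp only [LinearMap.sub_apply, LinearMap.smul_apply, ContinuousLinearMap.coe_coe, smul_eq_mul]
      rw [div_mul_cancel₀ _ hne0, sub_self]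
  obtain ⟨s, hs, hQs⟩ := hQ
  obtain ⟨x₁, hx₁, hgx₁⟩ : ∃ x ∈ s, g x ≠ g f₀ := by
    by_contra! hcon
    have h1 : ∀ x ∈ Q, g x = g f₀ := fun x hx => by
      rw [hQs] at hx
      exact convexHull_min (t := {y | g y = g f₀}) hcon (convex_hyperplane g.isLinear _) hx
    have h2 : vectorSpan ℝ Q ≤ LinearMap.ker g := by
      rw [vectorSpan_def, Submodule.span_le]
      rintro _ ⟨x, hx, y, hy, rfl⟩
      simp [h1 x hx, h1 y hy]
    exact hgv (h2 hvU)
  obtain ⟨g', hgF', hgq', hgx'⟩ : ∃ g : (ι → ℝ) →ₗ[ℝ] ℝ,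
      (∀ x ∈ F, g x = g f₀) ∧ g q = g f₀ ∧ g f₀ < g x₁ := by
    rcases hgx₁.lt_or_gt with hlt | hgt
    · exact ⟨-g, fun x hx => by simp [hgF x hx], by simp [hgq], by simpa using hlt⟩
    · exact ⟨g, hgF, hgq, hgt⟩
  have hsQ : s ⊆ Q := hQs ▸ subset_convexHull ℝ s
  -- Ratio test: the least ratio is the largest tilt `t` that keeps all generators on the valid
  -- side, and it is attained at the newly touched `x₂`.
  obtain ⟨x₂, ⟨hx₂, hgx₂⟩, hmin⟩ := Set.exists_min_image {x ∈ s | g' f₀ < g' x}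
    (fun x => (c - l x) / (g' x - g' f₀)) (hs.subset (Set.sep_subset _ _)) ⟨x₁, hx₁, hgx'⟩
  set t := (c - l x₂) / (g' x₂ - g' f₀) with ht
  have ht0 : 0 ≤ t := div_nonneg (sub_nonneg.mpr (hl x₂ (hsQ hx₂))) (sub_pos.mpr hgx₂).le
  let k : StrongDual ℝ (ι → ℝ) := l + t • LinearMap.toContinuousLinearMap g'
  have hk : ∀ x, k x = l x + t * g' x := fun x => by simp [k]
  have hkle : ∀ y ∈ Q, k y ≤ c + t * g' f₀ := by
    intro y hy
    rw [hQs] at hy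
    refine le_of_mem_convexHull k.toLinearMap (fun x hx => ?_) hy
    rw [ContinuousLinearMap.coe_coe, hk]
    rcases le_or_gt (g' x) (g' f₀) with h0 | h0
    · exact add_le_add (hl x (hsQ hx)) (mul_le_mul_of_nonneg_left h0 ht0)
    · have := hmin x ⟨hx, h0⟩
      simp only [le_div_iff₀ (sub_pos.mpr h0)] at this
      linarith
  have hFk : F ⊆ {x ∈ Q | k x = c + t * g' f₀} := fun x hx => by
    have h1 := hgF' x hx
    rw [hFl] at hx
    exact ⟨hx.1, by rw [hk, hx.2, h1]⟩
  have hx₂k : x₂ ∈ {x ∈ Q | k x = c + t * g' f₀} := by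
    refine ⟨hsQ hx₂, ?_⟩
    have : t * (g' x₂ - g' f₀) = c - l x₂ := div_mul_cancel₀ _ (sub_pos.mpr hgx₂).ne'
    rw [hk]; linarith
  refine ⟨_, isExposed_setOf_eq k (c + t * g' f₀) hkle, hFk, fun hqk => ?_, ?_⟩
  -- As `g'` has the same value at `q` as on `F`, tilting leaves the positive slack `c - l q`
  -- unchanged.
  · have := hqk.2
    rw [hk, hgq'] at this
    linarith
  · refine Submodule.finrank_lt_finrank_of_lt (lt_of_le_of_ne (vectorSpan_mono ℝ hFk) fun heq => ?_)
    have hm : x₂ - f₀ ∈ vectorSpan ℝ F := heq ▸ vsub_mem_vectorSpan ℝ hx₂k (hFk hf₀)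
    have : vectorSpan ℝ F ≤ LinearMap.ker g' := by
      rw [vectorSpan_def, Submodule.span_le]
      rintro _ ⟨x, hx, y, hy, rfl⟩
      simp [hgF' x hx, hgF' y hy]
    have := this hm
    rw [LinearMap.mem_ker, map_sub] at this
    linarith

/-- A nonempty face of a polytope and a point of the polytope off the face are separated by a
facet. -/
theorem IsExposed.exists_facet {ι : Type*} [Fintype ι] {Q F : Set (ι → ℝ)} {q : ι → ℝ}
    (hQ : IsPolytope Q) (hF : IsExposed ℝ Q F) (hne : F.Nonempty) (hq : q ∈ Q) (hqF : q ∉ F) :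
    ∃ F' ∈ facets Q, F ⊆ F' ∧ q ∉ F' := by
  -- Each tilt raises the dimension of the face, so the codimension in the ambient space decreases
  -- until a facet is reached.
  induction hn : Module.finrank ℝ (ι → ℝ) - Module.finrank ℝ (vectorSpan ℝ F)
    using Nat.strong_induction_on generalizing F with
  | _ n ih =>
    by_cases hdim : Module.finrank ℝ (vectorSpan ℝ F) + 1 = Module.finrank ℝ (vectorSpan ℝ Q)
    · exact ⟨F, ⟨hF, hne, hdim⟩, subset_rfl, hqF⟩
    · obtain ⟨F₁, hF₁, hsub, hqF₁, hlt⟩ := hF.exists_larger_face hQ hne hq hqF hdim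
      have hle := Submodule.finrank_le (vectorSpan ℝ F₁)
      obtain ⟨F', hF', hsub', hq'⟩ := ih _ (by omega) hF₁ (hne.mono hsub) hqF₁ rfl
      exact ⟨F', hF', hsub.trans hsub', hq'⟩

/-! ### Rectangles and disjoint pairs of sets -/

/-- The size of the intersection of two subsets of `Fin r`, given by their indicator functions. -/
def interCard {r : ℕ} (a b : Fin r → Bool) : ℕ := ∑ i, if a i = true ∧ b i = true then 1 else 0

/-- Prepends a Boolean to a Boolean vector. -/
def boolCons {r : ℕ} (x : Bool) (a : Fin r → Bool) : Fin (r + 1) → Bool := Fin.cons x a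

theorem interCard_boolCons {r : ℕ} (x y : Bool) (a b : Fin r → Bool) :
    interCard (boolCons x a) (boolCons y b) =
      (if x = true ∧ y = true then 1 else 0) + interCard a b := by
  rw [interCard, Fin.sum_univ_succ]
  simp [interCard, boolCons]

theorem sum_bool_fun_succ {r : ℕ} (f : (Fin (r + 1) → Bool) → ℕ) :
    ∑ a, f a = ∑ a : Fin r → Bool, (f (boolCons true a) + f (boolCons false a)) := by
  rw [← Equiv.sum_comp (Fin.consEquiv fun _ : Fin (r + 1) => Bool) f, Fintype.sum_prod_type_right]
  simp [Fin.consEquiv, boolCons]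

open Classical in
/-- The number of disjoint pairs in the rectangle `A × B`. -/
noncomputable def disjointPairs {r : ℕ} (A B : (Fin r → Bool) → Prop) : ℕ :=
  ∑ a, ∑ b, if A a ∧ B b ∧ interCard a b = 0 then 1 else 0

/-- Each element independently lies in the first set only, the second only, or neither. -/
theorem disjointPairs_univ (r : ℕ) :
    disjointPairs (fun _ : Fin r → Bool => True) (fun _ => True) = 3 ^ r := by
  induction r with
  | zero => simp [disjointPairs, interCard]
  | succ r ih =>
    simp only [disjointPairs, sum_bool_fun_succ, interCard_boolCons] at ih ⊢
    rw [pow_succ, ← ih, Finset.sum_mul]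
    refine Finset.sum_congr rfl fun a _ => ?_
    rw [Finset.sum_mul, ← Finset.sum_add_distrib]
    refine Finset.sum_congr rfl fun b _ => ?_
    by_cases h : interCard a b = 0 <;> simp [h]

/-- A rectangle without pairs of sets meeting in exactly one element contains at most `2 ^ r`
pairs of disjoint sets (Kaibel and Weltge). -/
theorem disjointPairs_le {r : ℕ} (A B : (Fin r → Bool) → Prop)
    (h : ∀ a b, A a → B b → interCard a b ≠ 1) : disjointPairs A B ≤ 2 ^ r := by
  induction r with
  | zero => 
    simp only [disjointPairs, Finset.univ_unique, Finset.sum_singleton, pow_zero]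
    split_ifs <;> simp
  | succ r ih =>
    -- Of the three ways to extend a disjoint pair to a disjoint pair, (true, false) and (false,
    -- true) cannot both occur, since the rectangle would then contain (true, true), which meets
    -- once. The former is charged to `h1`, the latter to `h2`, and (false, false) to whichever is
    -- left.
    have h1 := ih (fun a => A (boolCons true a) ∨ A (boolCons false a))
      (fun b => B (boolCons false b)) (by
        rintro a b (ha | ha) hb <;> simpa [interCard_boolCons] using h _ _ ha hb)
    have h2 := ih (fun a => A (boolCons false a))
      (fun b => B (boolCons true b) ∨ B (boolCons false b)) (by
        rintro a b ha (hb | hb) <;> simpa [interCard_boolCons] using h _ _ ha hb)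
    rw [pow_succ, mul_two]
    refine le_trans ?_ (add_le_add h1 h2)
    simp only [disjointPairs, sum_bool_fun_succ, interCard_boolCons]
    rw [← Finset.sum_add_distrib]
    refine Finset.sum_le_sum fun a _ => ?_
    simp only [← Finset.sum_add_distrib]
    refine Finset.sum_le_sum fun b _ => ?_
    by_cases hd : interCard a b = 0
    · have h3 : ¬(A (boolCons true a) ∧ B (boolCons true b)) := fun h4 =>
        h _ _ h4.1 h4.2 (by simp [interCard_boolCons, hd])
      by_cases a1 : A (boolCons true a) <;> by_cases a0 : A (boolCons false a) <;>
        by_cases b1 : B (boolCons true b) <;> by_cases b0 : B (boolCons false b) <;>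
        simp_all [interCard_boolCons]
    · simp [interCard_boolCons, hd]

/-- Rectangles that cover all disjoint pairs, none of which contains a pair of sets meeting in
exactly one element, number at least `(3/2) ^ r`. -/
theorem three_pow_le_card_mul {r : ℕ} {κ : Type*} [Fintype κ] (A B : κ → (Fin r → Bool) → Prop)
    (h : ∀ k a b, A k a → B k b → interCard a b ≠ 1)
    (hcover : ∀ a b : Fin r → Bool, interCard a b = 0 → ∃ k, A k a ∧ B k b) :
    3 ^ r ≤ Fintype.card κ * 2 ^ r := by
  classical
  rw [← disjointPairs_univ r]
  calc disjointPairs (fun _ : Fin r → Bool => True) (fun _ => True)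
      ≤ ∑ k, disjointPairs (A k) (B k) := by
        have hswap : ∑ k, disjointPairs (A k) (B k) = ∑ a : Fin r → Bool, ∑ b : Fin r → Bool, ∑ k,
            if A k a ∧ B k b ∧ interCard a b = 0 then 1 else 0 := by
          simp only [disjointPairs]
          rw [Finset.sum_comm]
          exact Finset.sum_congr rfl fun a _ => Finset.sum_comm
        rw [hswap]
        refine Finset.sum_le_sum fun a _ => Finset.sum_le_sum fun b _ => ?_
        split_ifs with hd
        · obtain ⟨k, hk⟩ := hcover a b hd.2.2
          refine le_trans ?_ (Finset.single_le_sum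
            (f := fun k => if A k a ∧ B k b ∧ interCard a b = 0 then 1 else 0)
            (fun _ _ => Nat.zero_le _) (Finset.mem_univ k))
          simp [hk, hd.2.2]
        · simp
    _ ≤ ∑ k : κ, 2 ^ r := Finset.sum_le_sum fun k _ => disjointPairs_le _ _ (h k)
    _ = Fintype.card κ * 2 ^ r := by simp

/-! ### Lower bounds on extension complexity -/

theorem ThreeDM.HasExtension.image {ι ι' : Type*} {P : Set (ι → ℝ)} {k : ℕ} (h : HasExtension P k)
    (f : (ι → ℝ) →ₗ[ℝ] (ι' → ℝ)) : HasExtension (f '' P) k := by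
  obtain ⟨d, Q, π, hQ, rfl, hk⟩ := h
  exact ⟨d, Q, f ∘ₗ π, hQ, by rw [LinearMap.coe_comp, Set.image_comp], hk⟩

/-- A polytope with points `x b` and faces `G a`, for all sets `a` and `b`, such that `x b` lies on
`G a` if `a` and `b` meet in one element and off `G a` if they are disjoint, has large extension
complexity. -/
theorem ThreeDM.HasExtension.three_pow_le {ι : Type*} [Fintype ι] {P : Set (ι → ℝ)} {k r : ℕ}
    (h : HasExtension P k) (G : (Fin r → Bool) → Set (ι → ℝ)) (x : (Fin r → Bool) → ι → ℝ)
    (hG : ∀ a, IsExposed ℝ P (G a)) (hx : ∀ b, x b ∈ P)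
    (hmem : ∀ a b, interCard a b = 1 → x b ∈ G a)
    (hnot : ∀ a b, interCard a b = 0 → x b ∉ G a) : 3 ^ r ≤ (k + 1) * 2 ^ r := by
  obtain ⟨d, Q, π, hQ, rfl, hk⟩ := h
  choose q hqQ hqx using hx
  have : Fintype (facets Q) := hQ.finite_facets.fintype
  have hcard : Fintype.card (facets Q) = k := by
    rw [← Set.coe_fintypeCard] at hk
    exact_mod_cast hk
  have hpre : ∀ a, IsExposed ℝ Q {y ∈ Q | π y ∈ G a} := by
    rintro a ⟨y₀, hy₀, hy₀'⟩
    obtain ⟨l, c, hl, hlG⟩ := (hG a).exists_eq_setOf_eq ⟨_, hy₀'⟩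
    have := isExposed_setOf_eq (A := Q) (l.comp (LinearMap.toContinuousLinearMap π)) c
      (fun y hy => hl _ ⟨y, hy, rfl⟩)
    have heq : {y ∈ Q | π y ∈ G a} =
        {y ∈ Q | (l.comp (LinearMap.toContinuousLinearMap π)) y = c} := by
      ext y
      refine and_congr_right fun hy => ?_
      rw [hlG]
      exact ⟨fun h => h.2, fun h => ⟨⟨y, hy, rfl⟩, h⟩⟩
    rw [heq]
    exact this (heq ▸ ⟨y₀, hy₀, hy₀'⟩)
  -- The rectangle of a facet pairs the sets whose face lies in it with the sets whose point lies
  -- off it. The extra index `none` takes care of the empty set `a`, whose face may be empty; this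
  -- is the `+ 1` in the bound.
  have := three_pow_le_card_mul (r := r) (κ := Option (facets Q))
    (fun o a => o.elim (a = fun _ => false) fun F => {y ∈ Q | π y ∈ G a} ⊆ F)
    (fun o b => o.elim True fun F => q b ∉ (F : Set _)) ?_ ?_
  · rwa [Fintype.card_option, hcard] at this
  · rintro (_ | F) a b ha hb hab
    · have ha' : a = fun _ => false := ha
      simp [interCard, ha'] at hab
    · exact hb (ha ⟨hqQ b, by rw [hqx]; exact hmem a b hab⟩)
  · intro a b hab
    by_cases ha : a = fun _ => false
    · exact ⟨none, ha, trivial⟩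
    · obtain ⟨i, hi⟩ : ∃ i, a i = true := by
        by_contra! hcon
        exact ha (funext fun i => by simpa using hcon i)
      have hne : {y ∈ Q | π y ∈ G a}.Nonempty := by
        -- The singleton `{i}` meets `a` in exactly one element, so its point lies on the face.
        refine ⟨q (fun j => decide (j = i)), hqQ _, ?_⟩
        rw [hqx]
        refine hmem _ _ ?_
        rw [interCard, Finset.sum_eq_single i] <;> simp +contextual [hi]
      obtain ⟨F, hF, hsub, hqF⟩ := (hpre a).exists_facet hQ hne (hqQ b)
        (fun h => hnot a b hab (by rw [← hqx]; exact h.2))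
      exact ⟨some ⟨F, hF⟩, hsub, hqF⟩

/-! ### Tight matchings of the reduction and satisfying assignments -/

section Reduction

open Classical in
/-- The characteristic vector of a set of hyperedges. -/
noncomputable def charVec {V : Type*} (H : TripleHypergraph V) (M : Finset (Finset V)) :
    {e // e ∈ H.edges} → ℝ := fun e => if e.1 ∈ M then 1 else 0

theorem matchingPolytope_eq {V : Type*} (H : TripleHypergraph V) :
    H.matchingPolytope = convexHull ℝ (charVec H '' {M | H.IsMatching M}) := by
  rw [TripleHypergraph.matchingPolytope]
  congr 1
  ext y
  exact ⟨fun ⟨M, hM, h⟩ => ⟨M, hM, h.symm⟩, fun ⟨M, hM, h⟩ => ⟨M, hM, h.symm⟩⟩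

theorem charVec_of_mem {V : Type*} {H : TripleHypergraph V} {M : Finset (Finset V)}
    {e : {e // e ∈ H.edges}} (h : e.1 ∈ M) : charVec H M e = 1 := if_pos h

theorem charVec_of_notMem {V : Type*} {H : TripleHypergraph V} {M : Finset (Finset V)}
    {e : {e // e ∈ H.edges}} (h : e.1 ∉ M) : charVec H M e = 0 := if_neg h

theorem charVec_nonneg {V : Type*} {H : TripleHypergraph V} {M : Finset (Finset V)}
    (e : {e // e ∈ H.edges}) : 0 ≤ charVec H M e := by
  by_cases h : e.1 ∈ M
  · simp [charVec_of_mem h]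
  · simp [charVec_of_notMem h]

theorem charVec_le_one {V : Type*} {H : TripleHypergraph V} {M : Finset (Finset V)}
    (e : {e // e ∈ H.edges}) : charVec H M e ≤ 1 := by
  by_cases h : e.1 ∈ M
  · simp [charVec_of_mem h]
  · simp [charVec_of_notMem h]

/-- Matchings are subsets of the finite edge set, so there are finitely many even if `V` is
infinite. -/
theorem isPolytope_matchingPolytope {V : Type*} (H : TripleHypergraph V) :
    IsPolytope H.matchingPolytope := by
  refine ⟨_, Set.Finite.image _ ?_, matchingPolytope_eq H⟩
  exact (Finset.finite_toSet H.edges.powerset).subset fun M hM => by simpa using hM.1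

variable {n m : ℕ} (Φ : Formula n m)

theorem mem_edges_iff {e : Finset (RVertex n m)} : e ∈ (reduction Φ).edges ↔
    (∃ i j, e = lightTriple i j) ∨ (∃ i j, e = darkTriple i j) ∨
    (∃ j p, e = clauseTriple (Φ j p) j) ∨ ∃ l j k, e = garbageTriple l j k := by
  simp only [reduction, Finset.mem_union, Finset.mem_image, Finset.mem_univ, true_and, Prod.exists,
    or_assoc, eq_comm (a := e)]

/-- The number of selected hyperedges of the gadget of the variable `i`. -/
noncomputable def variableSum (i : Fin n) : ({e // e ∈ (reduction Φ).edges} → ℝ) →ₗ[ℝ] ℝ :=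
  ∑ j : Fin m, ((LinearMap.proj (lightEdge Φ i j) : ({e // e ∈ (reduction Φ).edges} → ℝ) →ₗ[ℝ] ℝ) +
    LinearMap.proj (darkEdge Φ i j))

/-- The number of selected hyperedges of the gadget of the clause `j`. -/
noncomputable def clauseSum (j : Fin m) : ({e // e ∈ (reduction Φ).edges} → ℝ) →ₗ[ℝ] ℝ :=
  ∑ e with clauseA j ∈ e.1, LinearMap.proj e

theorem variableSum_apply (i : Fin n) (y : {e // e ∈ (reduction Φ).edges} → ℝ) :
    variableSum Φ i y = ∑ j : Fin m, (y (lightEdge Φ i j) + y (darkEdge Φ i j)) := by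
  simp [variableSum]

theorem clauseSum_apply (j : Fin m) (y : {e // e ∈ (reduction Φ).edges} → ℝ) :
    clauseSum Φ j y = ∑ e with clauseA j ∈ e.1, y e := by
  simp [clauseSum]

theorem lightTriple_ne_darkTriple (i i' : Fin n) (j j' : Fin m) :
    lightTriple i j ≠ darkTriple i' j' := fun h => by
  have : tip i false j ∈ darkTriple i' j' := h ▸ by simp [lightTriple]
  simp [darkTriple] at this

variable {Φ}

theorem eq_of_mem_of_mem {M : Finset (Finset (RVertex n m))}
    (hM : (reduction Φ).IsMatching M) {e f : Finset (RVertex n m)} (he : e ∈ M) (hf : f ∈ M) (v : RVertex n m)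
    (hve : v ∈ e) (hvf : v ∈ f) : e = f := by
  by_contra hne
  exact Finset.disjoint_left.mp (hM.2 e he f hf hne) hve hvf

theorem darkTriple_notMem {M : Finset (Finset (RVertex n m))}
    (hM : (reduction Φ).IsMatching M) {i : Fin n} {j : Fin m} (h : lightTriple i j ∈ M) :
    darkTriple i j ∉ M := fun h' =>
  lightTriple_ne_darkTriple i i j j
    (eq_of_mem_of_mem hM h h' (coreB i j) (by simp [lightTriple]) (by simp [darkTriple]))

theorem charVec_light_add_dark_le {M : Finset (Finset (RVertex n m))}
    (hM : (reduction Φ).IsMatching M) (i : Fin n) (j : Fin m) :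
    charVec _ M (lightEdge Φ i j) + charVec _ M (darkEdge Φ i j) ≤ 1 := by
  by_cases h : lightTriple i j ∈ M
  · rw [charVec_of_notMem (e := darkEdge Φ i j) (darkTriple_notMem hM h), add_zero]
    exact charVec_le_one _
  · rw [charVec_of_notMem (e := lightEdge Φ i j) h, zero_add]
    exact charVec_le_one _

theorem variableSum_charVec_le {M : Finset (Finset (RVertex n m))}
    (hM : (reduction Φ).IsMatching M) (i : Fin n) : variableSum Φ i (charVec _ M) ≤ m := by
  rw [variableSum_apply]
  exact (Finset.sum_le_sum fun j _ => charVec_light_add_dark_le hM i j).trans (by simp)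

theorem clauseSum_charVec_le {M : Finset (Finset (RVertex n m))}
    (hM : (reduction Φ).IsMatching M) (j : Fin m) : clauseSum Φ j (charVec _ M) ≤ 1 := by
  rw [clauseSum_apply]
  by_cases h : ∃ e : {e // e ∈ (reduction Φ).edges}, e.1 ∈ M ∧ clauseA j ∈ e.1
  · obtain ⟨e, he, hej⟩ := h
    rw [Finset.sum_eq_single e]
    · exact charVec_le_one e
    · intro f hf hne
      refine charVec_of_notMem fun hfM => hne (Subtype.ext ?_)
      exact eq_of_mem_of_mem hM hfM he _ (Finset.mem_filter.mp hf).2 hej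
    · exact fun h => absurd (Finset.mem_filter.mpr ⟨Finset.mem_univ e, hej⟩) h
  · rw [Finset.sum_eq_zero]
    · exact zero_le_one
    · exact fun f hf => charVec_of_notMem fun hfM => h ⟨f, hfM, (Finset.mem_filter.mp hf).2⟩

/-- In a perfectly matched variable gadget, every index has its light or its dark hyperedge. -/
theorem lightTriple_mem_or_darkTriple_mem {M : Finset (Finset (RVertex n m))}
    (hM : (reduction Φ).IsMatching M) {i : Fin n} (h : variableSum Φ i (charVec _ M) = m)
    (j : Fin m) : lightTriple i j ∈ M ∨ darkTriple i j ∈ M := by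
  rw [variableSum_apply] at h
  have h1 := (Finset.sum_eq_sum_iff_of_le
    (fun j _ => charVec_light_add_dark_le hM i j)).mp (by rw [h]; simp) j (Finset.mem_univ j)
  by_contra! hcon
  rw [charVec_of_notMem (e := lightEdge Φ i j) hcon.1,
    charVec_of_notMem (e := darkEdge Φ i j) hcon.2] at h1
  simp at h1

/-- A perfectly matched variable gadget has all its light hyperedges or none. -/
theorem lightTriple_mem_of_mem {M : Finset (Finset (RVertex n m))}
    (hM : (reduction Φ).IsMatching M) {i : Fin n} (h : variableSum Φ i (charVec _ M) = m)
    {j : Fin m} (hj : lightTriple i j ∈ M) (j' : Fin m) : lightTriple i j' ∈ M := by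
  -- The dark hyperedge at `j` shares `coreA` at `j + 1` with the light hyperedge there, so
  -- lightness passes from `j + 1` to `j`.
  have hstep : ∀ j, lightTriple i (finRotate m j) ∈ M → lightTriple i j ∈ M := fun j hj =>
    (lightTriple_mem_or_darkTriple_mem hM h j).resolve_right fun hd =>
      lightTriple_ne_darkTriple i i (finRotate m j) j
        (eq_of_mem_of_mem hM hj hd (coreA i (finRotate m j)) (by simp [lightTriple])
          (by simp [darkTriple]))
  obtain _ | m := m
  · exact j.elim0
  -- Go down from `j` to `0`, wrap around to the last index, and go down again to `j'`.
  · have h0 : lightTriple i 0 ∈ M := by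
      induction j using Fin.induction with
      | zero => exact hj
      | succ j ih => exact ih (hstep _ (by simpa [finRotate_apply] using hj))
    induction j' using Fin.reverseInduction with
    | last => exact hstep _ (by simpa [finRotate_apply] using h0)
    | cast j' ih => exact hstep _ (by simpa [finRotate_apply] using ih)

/-- The assignment read off a matching that is perfect on all gadgets is satisfying. -/
theorem satisfies_of_tight {M : Finset (Finset (RVertex n m))}
    (hM : (reduction Φ).IsMatching M) (hv : ∀ i, variableSum Φ i (charVec _ M) = m)
    (hc : ∀ j, clauseSum Φ j (charVec _ M) = 1) (t : Fin n → Fin m) :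
    Satisfies Φ fun i => decide (lightTriple i (t i) ∈ M) := by
  classical
  intro j
  obtain ⟨e, he, hej⟩ : ∃ e ∈ M, clauseA j ∈ e := by
    by_contra! hcon
    have := hc j
    rw [clauseSum_apply, Finset.sum_eq_zero] at this
    · simp at this
    · intro e he
      exact charVec_of_notMem fun h => hcon _ h (Finset.mem_filter.mp he).2
  obtain ⟨p, rfl⟩ : ∃ p, e = clauseTriple (Φ j p) j := by
    rcases (mem_edges_iff Φ).mp (hM.1 he) with ⟨i, j', rfl⟩ | ⟨i, j', rfl⟩ | ⟨j', p, rfl⟩ | ⟨l, j', k, rfl⟩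
    · simp [lightTriple] at hej
    · simp [darkTriple] at hej
    · simp only [clauseTriple, Finset.mem_insert, Finset.mem_singleton, reduceCtorEq, false_or,
        or_false, clauseA.injEq] at hej
      exact ⟨p, by rw [hej]⟩
    · simp [garbageTriple] at hej
  refine ⟨p, ?_⟩
  generalize Φ j p = l at he hej
  obtain ⟨i, b⟩ := l
  cases b
  -- For a negative literal, light hyperedges would cover the tip that the clause hyperedge uses;
  -- for a positive literal, the dark one at `j` would.
  · simp only [decide_eq_false_iff_not]
    intro hl
    have h2 := lightTriple_mem_of_mem hM (hv i) hl j
    have h3 := eq_of_mem_of_mem hM h2 he (tip i false j) (by simp [lightTriple])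
      (by simp [clauseTriple])
    rw [← h3] at hej
    simp [lightTriple] at hej
  · simp only [decide_eq_true_eq]
    have h2 : darkTriple i j ∉ M := fun h2 => by
      have h3 := eq_of_mem_of_mem hM h2 he (tip i true j) (by simp [darkTriple])
        (by simp [clauseTriple])
      rw [← h3] at hej
      simp [darkTriple] at hej
    exact lightTriple_mem_of_mem hM (hv i)
      ((lightTriple_mem_or_darkTriple_mem hM (hv i) j).resolve_right h2) _

variable (Φ)

/-- The hyperedges of the matching of an assignment `σ`: light or dark ones for each variable, and
for each clause `j` the one of its literal `p j`. -/
def assignmentTriple (σ : Fin n → Bool) (p : Fin m → Fin 3) :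
    (Fin n × Fin m) ⊕ Fin m → Finset (RVertex n m)
  | .inl q => if σ q.1 = true then lightTriple q.1 q.2 else darkTriple q.1 q.2
  | .inr j => clauseTriple (Φ j (p j)) j

/-- The matching of an assignment. -/
def assignmentMatching (σ : Fin n → Bool) (p : Fin m → Fin 3) : Finset (Finset (RVertex n m)) :=
  Finset.univ.image (assignmentTriple Φ σ p)

theorem isMatching_assignmentMatching {σ : Fin n → Bool} {p : Fin m → Fin 3}
    (hp : ∀ j, σ (Φ j (p j)).1 = (Φ j (p j)).2) :
    (reduction Φ).IsMatching (assignmentMatching Φ σ p) := by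
  constructor
  · intro e he
    obtain ⟨x, -, rfl⟩ := Finset.mem_image.mp he
    rw [mem_edges_iff]
    rcases x with ⟨i, j⟩ | j
    · by_cases h : σ i = true
      · exact Or.inl ⟨i, j, by simp [assignmentTriple, h]⟩
      · exact Or.inr (Or.inl ⟨i, j, by simp [assignmentTriple, h]⟩)
    · exact Or.inr (Or.inr (Or.inl ⟨j, p j, rfl⟩))
  -- The variable hyperedges cover only tips of false literals, while each clause hyperedge uses the
  -- tip of a true one.
  · have hmix : ∀ i j j', Disjoint (assignmentTriple Φ σ p (.inl (i, j)))
        (assignmentTriple Φ σ p (.inr j')) := by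
      intro i j j'
      have := hp j'
      cases h : σ i
      · simp only [assignmentTriple, h, Bool.false_eq_true, if_false, darkTriple, clauseTriple,
          Finset.disjoint_left, Finset.mem_insert, Finset.mem_singleton]
        rintro v (rfl | rfl | rfl) <;> simp
        rintro rfl h2
        rw [h2, h] at this
        cases this
      · simp only [assignmentTriple, h, if_true, lightTriple, clauseTriple, Finset.disjoint_left,
          Finset.mem_insert, Finset.mem_singleton]
        rintro v (rfl | rfl | rfl) <;> simp
        rintro rfl h2
        rw [h2, h] at this
        cases this
    intro e he f hf hne
    obtain ⟨x, -, rfl⟩ := Finset.mem_image.mp he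
    obtain ⟨y, -, rfl⟩ := Finset.mem_image.mp hf
    have hxy : x ≠ y := fun h => hne (h ▸ rfl)
    rcases x with ⟨i, j⟩ | j <;> rcases y with ⟨i', j'⟩ | j'
    · by_cases hi : i = i'
      · subst hi
        have hj : j ≠ j' := fun h => hxy (h ▸ rfl)
        by_cases h : σ i = true
        · simp [assignmentTriple, h, lightTriple, Finset.disjoint_left, hj]
        · simp [assignmentTriple, h, darkTriple, Finset.disjoint_left, hj]
      · by_cases h : σ i = true <;> by_cases h' : σ i' = true <;>
          simp [assignmentTriple, h, h', lightTriple, darkTriple, Finset.disjoint_left, hi]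
    · exact hmix i j j'
    · exact (hmix i' j' j).symm
    · have hj : j ≠ j' := fun h => hxy (h ▸ rfl)
      simp [assignmentTriple, clauseTriple, Finset.disjoint_left, hj]

theorem lightTriple_mem_assignmentMatching {σ : Fin n → Bool} {p : Fin m → Fin 3}
    (hp : ∀ j, σ (Φ j (p j)).1 = (Φ j (p j)).2) (i : Fin n) (j : Fin m) :
    lightTriple i j ∈ assignmentMatching Φ σ p ↔ σ i = true := by
  refine ⟨fun h => ?_, fun h => Finset.mem_image.mpr
    ⟨.inl (i, j), Finset.mem_univ _, by simp [assignmentTriple, h]⟩⟩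
  by_contra hσ
  exact darkTriple_notMem (isMatching_assignmentMatching Φ hp) h (Finset.mem_image.mpr
    ⟨.inl (i, j), Finset.mem_univ _, by simp [assignmentTriple, hσ]⟩)

theorem variableSum_assignmentMatching {σ : Fin n → Bool} {p : Fin m → Fin 3}
    (hp : ∀ j, σ (Φ j (p j)).1 = (Φ j (p j)).2) (i : Fin n) :
    variableSum Φ i (charVec _ (assignmentMatching Φ σ p)) = m := by
  rw [variableSum_apply, Finset.sum_congr rfl (g := fun _ => (1 : ℝ)), Finset.sum_const]
  · simp
  intro j _
  by_cases h : σ i = true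
  · have h1 := (lightTriple_mem_assignmentMatching Φ hp i j).mpr h
    rw [charVec_of_mem (e := lightEdge Φ i j) h1, charVec_of_notMem (e := darkEdge Φ i j)
      (darkTriple_notMem (isMatching_assignmentMatching Φ hp) h1), add_zero]
  · have h1 := mt (lightTriple_mem_assignmentMatching Φ hp i j).mp h
    have h2 : darkTriple i j ∈ assignmentMatching Φ σ p := Finset.mem_image.mpr
      ⟨.inl (i, j), Finset.mem_univ _, by simp [assignmentTriple, h]⟩
    rw [charVec_of_notMem (e := lightEdge Φ i j) h1, charVec_of_mem (e := darkEdge Φ i j) h2,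
      zero_add]

theorem clauseSum_assignmentMatching {σ : Fin n → Bool} {p : Fin m → Fin 3}
    (hp : ∀ j, σ (Φ j (p j)).1 = (Φ j (p j)).2) (j : Fin m) :
    clauseSum Φ j (charVec _ (assignmentMatching Φ σ p)) = 1 := by
  have hM := isMatching_assignmentMatching Φ hp
  refine le_antisymm (clauseSum_charVec_le hM j) ?_
  have h1 : clauseTriple (Φ j (p j)) j ∈ assignmentMatching Φ σ p :=
    Finset.mem_image.mpr ⟨.inr j, Finset.mem_univ _, rfl⟩
  rw [clauseSum_apply]
  refine le_trans (charVec_of_mem (e := ⟨_, hM.1 h1⟩) h1).ge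
    (Finset.single_le_sum (fun e _ => charVec_nonneg e) ?_)
  simp [clauseTriple]

/-- The number of selected hyperedges of all variable and clause gadgets. -/
noncomputable def gadgetSum : ({e // e ∈ (reduction Φ).edges} → ℝ) →ₗ[ℝ] ℝ :=
  ∑ i, variableSum Φ i + ∑ j, clauseSum Φ j

/-- A sum of upper bounds is attained only if each bound is, so one functional replaces the `n + m`
equations. -/
theorem gadgetSum_le {y : {e // e ∈ (reduction Φ).edges} → ℝ}
    (hv : ∀ i, variableSum Φ i y ≤ m) (hc : ∀ j, clauseSum Φ j y ≤ 1) :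
    gadgetSum Φ y ≤ n * m + m ∧ (gadgetSum Φ y = n * m + m ↔
      (∀ i, variableSum Φ i y = m) ∧ ∀ j, clauseSum Φ j y = 1) := by
  have h1 : ∑ i, variableSum Φ i y ≤ ∑ _i : Fin n, (m : ℝ) := Finset.sum_le_sum fun i _ => hv i
  have h2 : ∑ j, clauseSum Φ j y ≤ ∑ _j : Fin m, (1 : ℝ) := Finset.sum_le_sum fun i _ => hc i
  have e1 := Finset.sum_eq_sum_iff_of_le fun i (_ : i ∈ Finset.univ) => hv i
  have e2 := Finset.sum_eq_sum_iff_of_le fun j (_ : j ∈ Finset.univ) => hc j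
  simp only [Finset.sum_const, Finset.card_univ, Fintype.card_fin, nsmul_eq_mul, mul_one,
    Finset.mem_univ, true_implies] at h1 h2 e1 e2
  simp only [gadgetSum, LinearMap.add_apply, LinearMap.sum_apply]
  refine ⟨add_le_add h1 h2, ?_⟩
  rw [← e1, ← e2]
  exact ⟨fun h => ⟨by linarith, by linarith⟩, fun h => by rw [h.1, h.2]⟩

theorem gadgetSum_charVec_le {M : Finset (Finset (RVertex n m))}
    (hM : (reduction Φ).IsMatching M) : gadgetSum Φ (charVec _ M) ≤ n * m + m :=
  (gadgetSum_le Φ (variableSum_charVec_le hM) (clauseSum_charVec_le hM)).1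

theorem gadgetFace_eq : gadgetFace Φ =
    {y ∈ (reduction Φ).matchingPolytope | gadgetSum Φ y = n * m + m} := by
  ext y
  refine and_congr_right fun hy => ?_
  rw [matchingPolytope_eq] at hy
  have hv : ∀ i, variableSum Φ i y ≤ m := fun i => le_of_mem_convexHull _
    (by rintro _ ⟨M, hM, rfl⟩; exact variableSum_charVec_le hM i) hy
  have hc : ∀ j, clauseSum Φ j y ≤ 1 := fun i => le_of_mem_convexHull _
    (by rintro _ ⟨M, hM, rfl⟩; exact clauseSum_charVec_le hM i) hy
  rw [(gadgetSum_le Φ hv hc).2]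
  simp only [variableSum_apply, clauseSum_apply]

theorem gadgetSum_le_of_mem {y : {e // e ∈ (reduction Φ).edges} → ℝ}
    (hy : y ∈ (reduction Φ).matchingPolytope) : gadgetSum Φ y ≤ n * m + m := by
  rw [matchingPolytope_eq] at hy
  exact le_of_mem_convexHull _ (by rintro _ ⟨M, hM, rfl⟩; exact gadgetSum_charVec_le Φ hM) hy

theorem isExposed_gadgetFace : IsExposed ℝ (reduction Φ).matchingPolytope (gadgetFace Φ) := by
  rw [gadgetFace_eq]
  exact isExposed_setOf_eq (LinearMap.toContinuousLinearMap (gadgetSum Φ)) _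
    fun y hy => gadgetSum_le_of_mem Φ hy

/-- The projection to the coordinates of one light hyperedge for each variable. -/
def lightProj (t : Fin n → Fin m) :
    ({e // e ∈ (reduction Φ).edges} → ℝ) →ₗ[ℝ] (Fin n → ℝ) where
  toFun y i := y (lightEdge Φ i (t i))
  map_add' _ _ := rfl
  map_smul' _ _ := rfl

theorem lightProj_apply (t : Fin n → Fin m) (y : {e // e ∈ (reduction Φ).edges} → ℝ) (i : Fin n) :
    lightProj Φ t y i = y (lightEdge Φ i (t i)) := rfl

/-- Both sides are convex hulls, so it suffices to match the tight matchings with the satisfying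
assignments. The choice `t` is immaterial because the light hyperedges of a tight gadget are all in
or all out. -/
theorem lightProj_image_gadgetFace (t : Fin n → Fin m) :
    lightProj Φ t '' gadgetFace Φ = SATPolytope Φ := by
  rw [gadgetFace_eq, matchingPolytope_eq, setOf_mem_convexHull_and_eq, LinearMap.image_convexHull,
    SATPolytope]
  · congr 1
    ext x
    constructor
    · rintro ⟨_, ⟨⟨M, hM, rfl⟩, hs⟩, rfl⟩
      obtain ⟨hv, hc⟩ := (gadgetSum_le Φ (variableSum_charVec_le hM) (clauseSum_charVec_le hM)).2.mp hs
      refine ⟨_, satisfies_of_tight hM hv hc t, funext fun i => ?_⟩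
      by_cases h : lightTriple i (t i) ∈ M
      · simpa [lightProj_apply, h] using charVec_of_mem (e := lightEdge Φ i (t i)) h
      · simpa [lightProj_apply, h] using charVec_of_notMem (e := lightEdge Φ i (t i)) h
    · rintro ⟨σ, hσ, rfl⟩
      choose p hp using hσ
      have hM := isMatching_assignmentMatching Φ hp
      refine ⟨_, ⟨⟨_, hM, rfl⟩, (gadgetSum_le Φ (variableSum_charVec_le hM)
        (clauseSum_charVec_le hM)).2.mpr ⟨variableSum_assignmentMatching Φ hp,
          clauseSum_assignmentMatching Φ hp⟩⟩, funext fun i => ?_⟩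
      have h := lightTriple_mem_assignmentMatching Φ hp i (t i)
      by_cases h1 : σ i = true
      · simpa [lightProj_apply, h1] using charVec_of_mem (e := lightEdge Φ i (t i)) (h.mpr h1)
      · simpa [lightProj_apply, h1] using charVec_of_notMem (e := lightEdge Φ i (t i)) (mt h.mp h1)
  · rintro _ ⟨M, hM, rfl⟩
    exact gadgetSum_charVec_le Φ hM

end Reduction

/-! ### The correlation polytope as a SAT polytope -/

/-- The index of the variable for the pair `(i, j)` in the formula of the correlation polytope. -/
def pairVar {r : ℕ} (i j : Fin r) : Fin (r * r) := finProdFinEquiv (i, j)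

/-- The formula saying that `x_{ij} = x_{ii} ∧ x_{jj}` for all `i, j < r`. Its satisfying
assignments are the vertices of the correlation polytope. -/
def correlationFormula (r : ℕ) : Formula (r * r) (r * r * 3) := fun c =>
  let q := finProdFinEquiv.symm c
  let i := (finProdFinEquiv.symm q.1).1
  let j := (finProdFinEquiv.symm q.1).2
  -- The first two clauses are implications with two literals, padded by a repetition.
  ![![(pairVar i j, false), (pairVar i i, true), (pairVar i i, true)],
    ![(pairVar i j, false), (pairVar j j, true), (pairVar j j, true)],
    ![(pairVar i j, true), (pairVar i i, false), (pairVar j j, false)]] q.2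

theorem satisfies_correlationFormula {r : ℕ} (σ : Fin (r * r) → Bool) :
    Satisfies (correlationFormula r) σ ↔
      ∀ i j, σ (pairVar i j) = (σ (pairVar i i) && σ (pairVar j j)) := by
  have h1 : Satisfies (correlationFormula r) σ ↔ ∀ (i j : Fin r) (c : Fin 3), ∃ p : Fin 3,
      σ (correlationFormula r (finProdFinEquiv (finProdFinEquiv (i, j), c)) p).1 =
        (correlationFormula r (finProdFinEquiv (finProdFinEquiv (i, j), c)) p).2 := by
    refine ⟨fun h i j c => h _, fun h d => ?_⟩
    have := h (finProdFinEquiv.symm (finProdFinEquiv.symm d).1).1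
      (finProdFinEquiv.symm (finProdFinEquiv.symm d).1).2 (finProdFinEquiv.symm d).2
    rwa [Prod.mk.eta, Equiv.apply_symm_apply, Prod.mk.eta, Equiv.apply_symm_apply] at this
  rw [h1]
  refine forall_congr' fun i => forall_congr' fun j => ?_
  simp only [correlationFormula, Equiv.symm_apply_apply, Fin.forall_fin_succ, Fin.exists_fin_succ]
  cases h1 : σ (pairVar i j) <;> cases h2 : σ (pairVar i i) <;> cases h3 : σ (pairVar j j) <;>
    simp [h1, h2, h3]

/-- The functional `2 ∑ a_i x_{ii} - ∑ a_i a_j x_{ij}`. -/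
noncomputable def correlationFunctional {r : ℕ} (a : Fin r → Bool) :
    (Fin (r * r) → ℝ) →ₗ[ℝ] ℝ :=
  (2 : ℝ) • ∑ i, (if a i = true then (1 : ℝ) else 0) • LinearMap.proj (pairVar i i) -
    ∑ i, ∑ j, ((if a i = true then (1 : ℝ) else 0) * (if a j = true then 1 else 0)) •
      LinearMap.proj (pairVar i j)

/-- With `s = |a ∩ b|`, the linear part gives `2s` and the quadratic part factors as `s²`. The value
is thus at most `1`, with equality only for `s = 1`. -/
theorem correlationFunctional_apply {r : ℕ} (a b : Fin r → Bool) (x : Fin (r * r) → ℝ)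
    (hx : ∀ i j, x (pairVar i j) = (if b i = true then (1 : ℝ) else 0) * if b j = true then 1 else 0) :
    correlationFunctional a x = 1 - (1 - (interCard a b : ℝ)) ^ 2 := by
  have hs : (interCard a b : ℝ) =
      ∑ i, (if a i = true then (1 : ℝ) else 0) * (if b i = true then 1 else 0) := by
    rw [interCard, Nat.cast_sum]
    refine Finset.sum_congr rfl fun i _ => ?_
    cases a i <;> cases b i <;> simp
  have h1 : correlationFunctional a x = 2 * (interCard a b : ℝ) - (interCard a b : ℝ) ^ 2 := by
    rw [hs, sq, Finset.sum_mul_sum]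
    simp only [correlationFunctional, LinearMap.sub_apply, LinearMap.smul_apply,
      LinearMap.sum_apply, LinearMap.proj_apply, hx, smul_eq_mul]
    congr 1
    · congr 1
      refine Finset.sum_congr rfl fun i _ => ?_
      cases b i <;> simp
    · exact Finset.sum_congr rfl fun i _ => Finset.sum_congr rfl fun j _ => by ring
  rw [h1]; ring

theorem correlationFunctional_vertex {r : ℕ} (a : Fin r → Bool) {σ : Fin (r * r) → Bool}
    (hσ : Satisfies (correlationFormula r) σ) :
    correlationFunctional a (fun i => if σ i = true then 1 else 0) =
      1 - (1 - (interCard a fun i => σ (pairVar i i) : ℝ)) ^ 2 := by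
  refine correlationFunctional_apply _ _ _ fun i j => ?_
  rw [(satisfies_correlationFormula σ).mp hσ i j]
  cases σ (pairVar i i) <;> cases σ (pairVar j j) <;> simp

theorem correlationFunctional_le {r : ℕ} (a : Fin r → Bool) {x : Fin (r * r) → ℝ}
    (hx : x ∈ SATPolytope (correlationFormula r)) : correlationFunctional a x ≤ 1 := by
  refine le_of_mem_convexHull _ ?_ hx
  rintro _ ⟨σ, hσ, rfl⟩
  rw [correlationFunctional_vertex a hσ]
  linarith [sq_nonneg (1 - (interCard a fun i => σ (pairVar i i) : ℝ))]

theorem ThreeDM.HasExtension.three_pow_le_of_correlationFormula {r k : ℕ} (hr : 0 < r)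
    (h : HasExtension (reduction (correlationFormula r)).matchingPolytope k) :
    3 ^ r ≤ (k + 1) * 2 ^ r := by
  -- Any choice of light hyperedges works; index `0` exists because `0 < r`.
  let t : Fin (r * r) → Fin (r * r * 3) := fun _ => ⟨0, by positivity⟩
  have himg := lightProj_image_gadgetFace (correlationFormula r) t
  have hpt : ∀ b : Fin r → Bool, ∃ y ∈ gadgetFace (correlationFormula r), ∀ a,
      correlationFunctional a (lightProj _ t y) = 1 - (1 - (interCard a b : ℝ)) ^ 2 := by
    intro b
    let σ : Fin (r * r) → Bool :=
      fun q => b (finProdFinEquiv.symm q).1 && b (finProdFinEquiv.symm q).2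
    have hb : (fun i => σ (pairVar i i)) = b := by
      ext i
      simp only [σ, pairVar, Equiv.symm_apply_apply, Bool.and_self]
    have hσ : Satisfies (correlationFormula r) σ :=
      (satisfies_correlationFormula σ).mpr fun i j => by
        simp only [σ, pairVar, Equiv.symm_apply_apply, Bool.and_self]
    have hmem : (fun i => if σ i = true then (1 : ℝ) else 0) ∈
        SATPolytope (correlationFormula r) := subset_convexHull ℝ _ ⟨σ, hσ, rfl⟩
    rw [← himg] at hmem
    obtain ⟨y, hy, hyσ⟩ := hmem
    refine ⟨y, hy, fun a => ?_⟩
    rw [hyσ, correlationFunctional_vertex a hσ, hb]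
  choose y hyF hy using hpt
  refine h.three_pow_le (r := r) (fun a => {y ∈ gadgetFace (correlationFormula r) |
    correlationFunctional a (lightProj _ t y) = 1}) y (fun a => ?_) (fun b => (hyF b).1) ?_ ?_
  · refine (isExposed_gadgetFace _).trans_of_isPolytope (isPolytope_matchingPolytope _) ?_
    exact isExposed_setOf_eq
      (LinearMap.toContinuousLinearMap (correlationFunctional a ∘ₗ lightProj _ t)) 1
      fun y hy => correlationFunctional_le a (himg ▸ ⟨y, hy, rfl⟩)
  · intro a b hab
    exact ⟨hyF b, by rw [hy, hab]; simp⟩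
  · intro a b hab hmem
    have := hmem.2
    rw [hy, hab] at this
    norm_num at this

/-! ### Relabelling of vertices and numerical estimates -/

/-- The image of a hypergraph under a bijection of the vertices. -/
def mapHypergraph {V W : Type*} (H : TripleHypergraph V) (f : V ≃ W) : TripleHypergraph W where
  edges := H.edges.map (Finset.mapEmbedding f.toEmbedding).toEmbedding
  card_edge e he := by
    obtain ⟨e₀, he₀, rfl⟩ := Finset.mem_map.mp he
    simpa using H.card_edge e₀ he₀

/-- The identification of the coordinates along a bijection of the vertices. -/
def mapHypergraphProj {V W : Type*} (H : TripleHypergraph V) (f : V ≃ W) :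
    ({e // e ∈ (mapHypergraph H f).edges} → ℝ) →ₗ[ℝ] ({e // e ∈ H.edges} → ℝ) where
  toFun y e := y ⟨e.1.map f.toEmbedding, Finset.mem_map_of_mem _ e.2⟩
  map_add' _ _ := rfl
  map_smul' _ _ := rfl

/-- Moves an extension for the hypergraph on `Fin N` back to the reduction; only this direction is
needed for a lower bound. -/
theorem mapHypergraphProj_image {V W : Type*} (H : TripleHypergraph V) (f : V ≃ W) :
    mapHypergraphProj H f '' (mapHypergraph H f).matchingPolytope = H.matchingPolytope := by
  classical
  rw [matchingPolytope_eq, matchingPolytope_eq, LinearMap.image_convexHull]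
  congr 1
  ext y
  constructor
  · rintro ⟨_, ⟨M, hM, rfl⟩, rfl⟩
    refine ⟨H.edges.filter fun e => e.map f.toEmbedding ∈ M,
      ⟨Finset.filter_subset _ _, fun e he e' he' hne => ?_⟩, funext fun e => ?_⟩
    · have := hM.2 _ (Finset.mem_filter.mp he).2 _ (Finset.mem_filter.mp he').2
        (fun h => hne (Finset.map_injective _ h))
      exact (Finset.disjoint_map _).mp this
    · simp [mapHypergraphProj, charVec]
  · rintro ⟨M, hM, rfl⟩
    refine ⟨_, ⟨M.map (Finset.mapEmbedding f.toEmbedding).toEmbedding,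
      ⟨Finset.map_subset_map.mpr hM.1, ?_⟩, rfl⟩, funext fun e => ?_⟩
    · intro e he e' he' hne
      obtain ⟨e₀, he₀, rfl⟩ := Finset.mem_map.mp he
      obtain ⟨e₁, he₁, rfl⟩ := Finset.mem_map.mp he'
      exact (Finset.disjoint_map _).mpr (hM.2 e₀ he₀ e₁ he₁ fun h => hne (h ▸ rfl))
    · have : e.1.map f.toEmbedding ∈ M.map (Finset.mapEmbedding f.toEmbedding).toEmbedding ↔
          e.1 ∈ M := Finset.mem_map' (Finset.mapEmbedding f.toEmbedding).toEmbedding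
      simp only [mapHypergraphProj, charVec, LinearMap.coe_mk, AddHom.coe_mk, this]

theorem card_RVertex_le (n m : ℕ) : Fintype.card (RVertex n m) ≤ 8 * (n * m) + 2 * m := by
  let f : RVertex n m → (Fin n × Bool × Fin m) ⊕ (Bool × Fin n × Fin m) ⊕ (Bool × Fin m) ⊕
      (Bool × Fin (m * (n - 1)))
    | .tip i b j => .inl (i, b, j)
    | .coreA i j => .inr (.inl (true, i, j))
    | .coreB i j => .inr (.inl (false, i, j))
    | .clauseA j => .inr (.inr (.inl (true, j)))
    | .clauseB j => .inr (.inr (.inl (false, j)))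
    | .garbageA k => .inr (.inr (.inr (true, k)))
    | .garbageB k => .inr (.inr (.inr (false, k)))
  have hf : Function.Injective f := by
    intro x y h
    cases x <;> cases y <;> simp_all [f]
  have h1 := Fintype.card_le_of_injective f hf
  simp only [Fintype.card_sum, Fintype.card_prod, Fintype.card_fin, Fintype.card_bool] at h1
  have h2 : m * (n - 1) ≤ n * m := by rw [mul_comm n m]; exact Nat.mul_le_mul_left _ (Nat.sub_le _ _)
  have h3 : n * (2 * m) = 2 * (n * m) := by ring
  omega

theorem two_rpow_le_of_three_pow_le {r k : ℕ} (hr : 4 ≤ r) (h : 3 ^ r ≤ (k + 1) * 2 ^ r) :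
    (2 : ℝ) ^ ((1 / 4 : ℝ) * r) ≤ k := by
  have h1 : ((3 : ℝ) / 2) ^ r ≤ k + 1 := by
    rw [div_pow, div_le_iff₀ (by positivity)]
    exact_mod_cast h
  -- Split `3/2 = (5/4)(6/5)`: `5/4` exceeds `2^(1/4)`, and `(6/5)^r ≥ (6/5)^4 > 2` absorbs the `+
  -- 1`.
  have h2 : (2 : ℝ) ^ ((1 / 4 : ℝ) * r) ≤ (5 / 4) ^ r := by
    rw [Real.rpow_mul (by norm_num), Real.rpow_natCast]
    refine pow_le_pow_left₀ (by positivity) ?_ r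
    refine le_of_pow_le_pow_left₀ (n := 4) (by norm_num) (by norm_num) ?_
    rw [← Real.rpow_natCast, ← Real.rpow_mul (by norm_num)]
    norm_num
  have h3 : ((5 : ℝ) / 4) ^ 4 ≤ (5 / 4) ^ r := pow_le_pow_right₀ (by norm_num) hr
  have h4 : ((6 : ℝ) / 5) ^ 4 ≤ (6 / 5) ^ r := pow_le_pow_right₀ (by norm_num) hr
  have h5 : ((3 : ℝ) / 2) ^ r = (5 / 4) ^ r * (6 / 5) ^ r := by rw [← mul_pow]; norm_num
  norm_num at h3 h4
  nlinarith

theorem exists_hypergraph_extensionComplexity_ge (n : ℕ) (hn : 1 ≤ n) :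
    ∃ (N : ℕ) (H : TripleHypergraph (Fin N)), N ≤ 18750 * n ∧
      (2 : ℝ) ^ ((1 / 4 : ℝ) * (n : ℝ) ^ ((1 : ℝ) / 4)) ≤
        (extensionComplexity H.matchingPolytope : ℝ) := by
  set x : ℝ := (n : ℝ) ^ ((1 : ℝ) / 4) with hx
  have hn' : (1 : ℝ) ≤ n := by exact_mod_cast hn
  have hx1 : 1 ≤ x := Real.one_le_rpow hn' (by norm_num)
  have hx4 : x ^ 4 = n := by
    rw [hx, ← Real.rpow_natCast, ← Real.rpow_mul (by linarith)]
    norm_num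
  -- The summand `3` ensures `r ≥ 4`, and `r < x + 4 ≤ 5x` because `x ≥ 1`.
  set r := ⌈x⌉₊ + 3 with hr
  have hceil : 1 ≤ ⌈x⌉₊ := Nat.one_le_iff_ne_zero.mpr (Nat.ceil_pos.mpr (by linarith)).ne'
  have hxr : x ≤ r := by rw [hr]; push_cast; linarith [Nat.le_ceil x]
  have hrx : (r : ℝ) ≤ 5 * x := by
    rw [hr]; push_cast
    linarith [Nat.ceil_lt_add_one (by linarith : (0 : ℝ) ≤ x)]
  have hr4 : r ^ 4 ≤ 625 * n := by
    have : (r : ℝ) ^ 4 ≤ (5 * x) ^ 4 := pow_le_pow_left₀ (by positivity) hrx 4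
    rw [mul_pow, hx4] at this
    norm_num at this
    exact_mod_cast this
  let H := reduction (correlationFormula r)
  let f : RVertex (r * r) (r * r * 3) ≃ Fin (Fintype.card (RVertex (r * r) (r * r * 3))) :=
    Fintype.equivFin _
  refine ⟨_, mapHypergraph H f, ?_, ?_⟩
  · refine (card_RVertex_le _ _).trans ?_
    -- The vertex count is at most `24r⁴ + 6r² ≤ 30r⁴ ≤ 30 · 625 n`, which is the constant `18750`.
    have h2 : r * r ≤ r ^ 4 := by
      rw [← sq]; exact Nat.pow_le_pow_right (by omega) (by norm_num)
    have h3 : r * r * (r * r * 3) = 3 * r ^ 4 := by ring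
    omega
  · have hext : HasExtension (mapHypergraph H f).matchingPolytope
        (extensionComplexity (mapHypergraph H f).matchingPolytope) :=
      -- The infimum of an empty set of naturals is `0`, so attainment needs the existence of some
      -- extension.
      Nat.sInf_mem (isPolytope_matchingPolytope _).exists_hasExtension
    have h1 := hext.image (mapHypergraphProj H f)
    rw [mapHypergraphProj_image] at h1
    refine le_trans ?_ (two_rpow_le_of_three_pow_le (by omega)
      (h1.three_pow_le_of_correlationFormula (by omega)))
    exact Real.rpow_le_rpow_of_exponent_le (by norm_num) (by gcongr)

theorem mainTheorem8 :
    (∀ (n m : ℕ) (Φ : ThreeDM.Formula n m), 1 ≤ m →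
      IsExposed ℝ (ThreeDM.reduction Φ).matchingPolytope (ThreeDM.gadgetFace Φ) ∧
      ∀ t : Fin n → Fin m,
        (fun (y : {e // e ∈ (ThreeDM.reduction Φ).edges} → ℝ) (i : Fin n) =>
          y (ThreeDM.lightEdge Φ i (t i))) '' ThreeDM.gadgetFace Φ = ThreeDM.SATPolytope Φ) ∧
    (∃ (C : ℕ) (c : ℝ), 0 < c ∧ ∀ n : ℕ, 1 ≤ n →
      ∃ (N : ℕ) (H : ThreeDM.TripleHypergraph (Fin N)), N ≤ C * n ∧
        (2 : ℝ) ^ (c * (n : ℝ) ^ ((1 : ℝ) / 4)) ≤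
          (ThreeDM.extensionComplexity H.matchingPolytope : ℝ)) :=
  ⟨fun _ _ Φ _ => ⟨isExposed_gadgetFace Φ, lightProj_image_gadgetFace Φ⟩,
    18750, 1 / 4, by norm_num, exists_hypergraph_extensionComplexity_ge⟩
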